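/- Let $\mu$ be a probability measure on $\mathbb{R}$ that is supported on $[0,1]$ and absolutely continuous with respect to Lebesgue measure, with distribution function $F_\mu$, and let $q\in[0,1]$. For $y\in[0,1]$ let $R_{\mu,q}(y)\in[0,1]$ be a solution $r$ (the smallest one, if there are several) of $\mu([y-r,y+r])=q$, and put $$\mathcal{W}(y)=\int_{[y-R_{\mu,q}(y),\,y+R_{\mu,q}(y)]}|x-y|\,d\mu(x).$$ For $n$ agents at $\vec x=(x_1,\dots,x_n)$ and a facility at $y\in\mathbb{R}$, the $\lfloor qn\rfloor$ agents closest to $y$ (ties broken by label) are accommodated; an accommodated agent $i$ has utility $1-|x_i-y|$ and every other agent has utility $0$. Let $SW(\vec x;y)$ be the sum of all utilities divided by $n$, and $SW_{opt}(\vec x)=\sup_{y\in\mathbb{R}}SW(\vec x;y)$. For $p\in[0,1]$ the percentile mechanism $\mathcal{PM}_p$ places the facility at the position of the $(\lfloor p(n-1)\rfloor+1)$-th leftmost agent; $SW_p(\vec x)$ denotes the resulting value of $SW$. Let $\vec X_n=(X_1,\dots,X_n)$ be i.i.d. with law $\mu$. Then $R_{\mu,q}$ is well defined on $[0,1]$,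 i.e. the equation has a smallest solution in $[0,1]$ for every $y\in[0,1]$; the problem $\min_{y\in[0,1]}\mathcal{W}(y)$ has at least one solution; and for every solution $\bar y$ the percentile mechanism with percentile $\bar p=F_\mu(\bar y)$ is asymptotically optimal: $$\lim_{n\to\infty}\mathbb{E}[SW_{\bar p}(\vec X_n)]=\lim_{n\to\infty}\mathbb{E}[SW_{opt}(\vec X_n)]=q-\mathcal{W}(\bar y),$$ so that $\limsup_{n\to\infty}\mathbb{E}[SW_p(\vec X_n)]\le q-\mathcal{W}(\bar y)$ for every $p\in[0,1]$, and, if $q>0$, the Bayesian approximation ratio $\mathbb{E}[SW_{opt}(\vec X_n)]/\mathbb{E}[SW_{\bar p}(\vec X_n)]$ tends to $1$. -/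

import Mathlib

open MeasureTheory ProbabilityTheory Filter Topology Set

namespace FLPSR

noncomputable section

/-- The radius function `R_{μ,q}`: the solution `r ∈ [0,1]` of `μ([y - r, y + r]) = q`.
When the density vanishes on an interval, several `r` may solve the equation; the corresponding
intervals differ by a `μ`-null set, and the smallest solution is taken. -/
def radius (μ : Measure ℝ) (q y : ℝ) : ℝ :=
  sInf {r : ℝ | r ∈ Icc (0 : ℝ) 1 ∧ μ.real (Icc (y - r) (y + r)) = q}

/-- The objective `𝒲(y) = ∫_{[y - R(y), y + R(y)]} |x - y| dμ(x)`. -/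
def cost (μ : Measure ℝ) (q y : ℝ) : ℝ :=
  ∫ x in Icc (y - radius μ q y) (y + radius μ q y), |x - y| ∂μ

/-- The number `⌊q n⌋` of agents that the facility can accommodate. -/
def capacity (q : ℝ) (n : ℕ) : ℕ := ⌊q * (n : ℝ)⌋₊

/-- The rank (starting from `0`) of agent `i` when the agents are ordered by increasing distance
from the facility at `y`, ties being broken by the agents' labels. -/
def distRank {n : ℕ} (x : Fin n → ℝ) (y : ℝ) (i : Fin n) : Fin n :=
  (Tuple.sort fun j => |x j - y|).symm i

/-- The utility of agent `i` in the first-come-first-served game with one facility at `y`: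
`1 - |x_i - y|` if the agent is among the `⌊q n⌋` agents closest to `y`, and `0` otherwise. -/
def utility (q : ℝ) {n : ℕ} (x : Fin n → ℝ) (y : ℝ) (i : Fin n) : ℝ :=
  if (distRank x y i : ℕ) < capacity q n then 1 - |x i - y| else 0

/-- The social welfare of the facility position `y`, normalised by the number of agents. -/
def welfare (q : ℝ) {n : ℕ} (x : Fin n → ℝ) (y : ℝ) : ℝ :=
  (1 / (n : ℝ)) * ∑ i, utility q x y i

/-- The optimal social welfare for the positions `x`. -/
def optWelfare (q : ℝ) {n : ℕ} (x : Fin n → ℝ) : ℝ := ⨆ y : ℝ, welfare q x y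

/-- The percentile mechanism: the facility is placed at the position of the
`(⌊p (n - 1)⌋ + 1)`-th leftmost agent. For `n ≥ 1` and `p ∈ [0,1]` the first branch applies. -/
def percentileMechanism (p : ℝ) {n : ℕ} (x : Fin n → ℝ) : ℝ :=
  if h : ⌊p * ((n : ℝ) - 1)⌋₊ < n then x (Tuple.sort x ⟨⌊p * ((n : ℝ) - 1)⌋₊, h⟩) else 0

/-- Expected social welfare of the percentile mechanism for `n` i.i.d. agents of law `μ`. -/
def expPercentileWelfare (μ : Measure ℝ) (q p : ℝ) (n : ℕ) : ℝ :=
  ∫ x : Fin n → ℝ, welfare q x (percentileMechanism p x) ∂(Measure.pi fun _ => μ)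

/-- Expected optimal social welfare for `n` i.i.d. agents of law `μ`. -/
def expOptWelfare (μ : Measure ℝ) (q : ℝ) (n : ℕ) : ℝ :=
  ∫ x : Fin n → ℝ, optWelfare q x ∂(Measure.pi fun _ => μ)

end

end FLPSR

/-! The proof rests on linear-programming duality for the welfare. With `k` places, the sum of
utilities is the minimum over `t` of `k (1 - t) + ∑ (t - |x_i - y|)⁺`, attained at the distance of
the last accommodated agent. Likewise `q - 𝒲(y)` is the minimum over `t` of `q (1 - t) + ∫ (t - |x -
y|)⁺ dμ`, attained at the radius (`mul_sub_cost_le_tent`, `tent_radius_eq`). Ranks and radii thus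
give way to averages of tent functions, which are Lipschitz in `(t, y)`. The strong law at rational
parameters then makes the welfare converge to `q - 𝒲`, uniformly on `[0,1]`, which settles the
optimal welfare.

The percentile mechanism needs one more idea, because the agent at percentile `F_μ(ȳ)` need not
converge to `ȳ` where `F_μ` is flat. Its limit points `z` do satisfy `F_μ(z) = F_μ(ȳ)`, and
`cost_eq_of_cdf_eq` shows that `𝒲(z) = 𝒲(ȳ)`: on the optimal ball `B`, the minimizer `ȳ` is a median
of `μ` restricted to `B`, and so is every point of the same level of `F_μ`. Bounded convergence
passes to expectations. -/

namespace FLPSR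

/-! ### Finitely many agents -/

/-- The average over the agents of the tent function `(t - |x_i - y|)⁺`. -/
noncomputable def empiricalTent {n : ℕ} (x : Fin n → ℝ) (t y : ℝ) : ℝ :=
  (1 / (n : ℝ)) * ∑ i, max (t - |x i - y|) 0

lemma capacity_le {q : ℝ} (hq1 : q ≤ 1) (n : ℕ) : capacity q n ≤ n := by
  refine Nat.floor_le_of_le ?_
  have : (0 : ℝ) ≤ n := n.cast_nonneg
  nlinarith

lemma sum_fin_ite_lt {n k : ℕ} (hk : k ≤ n) :
    ∑ j : Fin n, (if (j : ℕ) < k then (1 : ℝ) else 0) = k := by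
  rw [Fin.sum_univ_eq_sum_range (fun j => if j < k then (1 : ℝ) else 0) n, ← Finset.sum_filter]
  have : (Finset.range n).filter (· < k) = Finset.range k := by
    ext j; simp only [Finset.mem_filter, Finset.mem_range]; omega
  simp [this]

lemma sum_utility_eq (q : ℝ) {n : ℕ} (x : Fin n → ℝ) (y : ℝ) :
    ∑ i, utility q x y i = ∑ j : Fin n, if (j : ℕ) < capacity q n
      then 1 - |x (Tuple.sort (fun j => |x j - y|) j) - y| else 0 := by
  rw [← Equiv.sum_comp (Tuple.sort fun j => |x j - y|)]
  simp [utility, distRank]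

/-- Weak duality, term by term after sorting: an accommodated agent at distance `d` has `1 - d ≤ (1
- t) + (t - d)⁺`, and any other has `0 ≤ (t - d)⁺`. -/
lemma sum_utility_le {q : ℝ} (hq1 : q ≤ 1) {n : ℕ} (x : Fin n → ℝ) (y t : ℝ) :
    ∑ i, utility q x y i ≤ capacity q n * (1 - t) + ∑ i, max (t - |x i - y|) 0 := by
  rw [sum_utility_eq, ← sum_fin_ite_lt (capacity_le hq1 n), Finset.sum_mul,
    ← Equiv.sum_comp (Tuple.sort fun j => |x j - y|) (fun i => max (t - |x i - y|) 0),
    ← Finset.sum_add_distrib]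
  refine Finset.sum_le_sum fun j _ => ?_
  have h1 := le_max_left (t - |x (Tuple.sort (fun j => |x j - y|) j) - y|) 0
  have h2 := le_max_right (t - |x (Tuple.sort (fun j => |x j - y|) j) - y|) 0
  split_ifs <;> linarith

lemma exists_sum_utility_eq {q : ℝ} (hq1 : q ≤ 1) {n : ℕ} (x : Fin n → ℝ) (y : ℝ) :
    ∃ t : ℝ, 0 ≤ t ∧ ((∀ i, |x i - y| ≤ 1) → t ≤ 1) ∧
      ∑ i, utility q x y i = capacity q n * (1 - t) + ∑ i, max (t - |x i - y|) 0 := by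
  have hk := capacity_le hq1 n
  rcases Nat.eq_zero_or_pos (capacity q n) with h0 | hpos
  -- Without places both sides vanish at `t = 0`.
  · refine ⟨0, le_rfl, fun _ => zero_le_one, ?_⟩
    simp [utility, h0]
  · have hmono := Tuple.monotone_sort fun j => |x j - y|
    set σ := Tuple.sort fun j => |x j - y| with hσ
    -- Ranks start from `0`, so this is the last accommodated agent; at its distance every termwise
    -- inequality of weak duality is tight.
    let m : Fin n := ⟨capacity q n - 1, by omega⟩
    refine ⟨|x (σ m) - y|, abs_nonneg _, fun h => h _, ?_⟩
    rw [sum_utility_eq, ← sum_fin_ite_lt hk, Finset.sum_mul,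
      ← Equiv.sum_comp σ (fun i => max (|x (σ m) - y| - |x i - y|) 0),
      ← Finset.sum_add_distrib]
    refine Finset.sum_congr rfl fun j _ => ?_
    split_ifs with hj
    · have : |x (σ j) - y| ≤ |x (σ m) - y| :=
        hmono (show j ≤ m from Fin.le_def.2 (by simp only [m]; omega))
      rw [max_eq_left (by linarith)]
      ring
    · have : |x (σ m) - y| ≤ |x (σ j) - y| :=
        hmono (show m ≤ j from Fin.le_def.2 (by simp only [m]; omega))
      rw [max_eq_right (by linarith)]
      ring

lemma welfare_le {q : ℝ} (hq1 : q ≤ 1) {n : ℕ} (x : Fin n → ℝ) (y t : ℝ) :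
    welfare q x y ≤ capacity q n / n * (1 - t) + empiricalTent x t y := by
  have h := mul_le_mul_of_nonneg_left (sum_utility_le hq1 x y t)
    (by positivity : (0 : ℝ) ≤ 1 / n)
  rw [welfare, empiricalTent]
  exact h.trans_eq (by ring)

lemma exists_welfare_eq {q : ℝ} (hq1 : q ≤ 1) {n : ℕ} (x : Fin n → ℝ) (y : ℝ) :
    ∃ t : ℝ, 0 ≤ t ∧ ((∀ i, |x i - y| ≤ 1) → t ≤ 1) ∧
      welfare q x y = capacity q n / n * (1 - t) + empiricalTent x t y := by
  obtain ⟨t, h0, h1, h⟩ := exists_sum_utility_eq hq1 x y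
  refine ⟨t, h0, h1, ?_⟩
  rw [welfare, empiricalTent, h]
  ring

lemma empiricalTent_le_add {n : ℕ} {x x' : Fin n → ℝ} {t t' y y' δ : ℝ} (hδ : 0 ≤ δ)
    (h : ∀ i, t - |x i - y| ≤ t' - |x' i - y'| + δ) :
    empiricalTent x t y ≤ empiricalTent x' t' y' + δ := by
  rcases Nat.eq_zero_or_pos n with rfl | hn
  · simpa [empiricalTent] using hδ
  have hn' : (0 : ℝ) < n := by exact_mod_cast hn
  have key : ∑ i, max (t - |x i - y|) 0 ≤ ∑ i, (max (t' - |x' i - y'|) 0 + δ) := by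
    refine Finset.sum_le_sum fun i _ => max_le ?_ ?_
    · exact (h i).trans (by gcongr; exact le_max_left _ _)
    · exact add_nonneg (le_max_right _ _) hδ
  rw [Finset.sum_add_distrib, Finset.sum_const, Finset.card_univ, Fintype.card_fin,
    nsmul_eq_mul] at key
  have := mul_le_mul_of_nonneg_left key (by positivity : (0 : ℝ) ≤ 1 / n)
  rw [empiricalTent, empiricalTent]
  refine this.trans_eq ?_
  field_simp

/-- Choose `t` optimal for the right-hand side and apply weak duality with the same `t` on the left.
Changes in who is accommodated never have to be tracked. -/
lemma welfare_le_add {q : ℝ} (hq1 : q ≤ 1) {n : ℕ} {x x' : Fin n → ℝ} {y y' δ : ℝ} (hδ : 0 ≤ δ)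
    (h : ∀ i, |x' i - y'| ≤ |x i - y| + δ) :
    welfare q x y ≤ welfare q x' y' + δ := by
  obtain ⟨t, -, -, ht⟩ := exists_welfare_eq hq1 x' y'
  rw [ht]
  have := empiricalTent_le_add (x := x) (y := y) (x' := x') (y' := y') (t := t) (t' := t)
    hδ fun i => by linarith [h i]
  linarith [welfare_le hq1 x y t]

lemma abs_sub_le_add {a b c d : ℝ} : |a - b| ≤ |c - d| + (|a - c| + |b - d|) := by
  have : a - b = (c - d) + ((a - c) + (d - b)) := by ring
  rw [this, abs_sub_comm b d]
  exact (abs_add_le _ _).trans (by gcongr; exact abs_add_le _ _)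

lemma lipschitzWith_welfare {q : ℝ} (hq1 : q ≤ 1) (n : ℕ) :
    LipschitzWith 2 fun z : (Fin n → ℝ) × ℝ => welfare q z.1 z.2 := by
  refine LipschitzWith.of_le_add_mul 2 fun z w => welfare_le_add hq1 (by positivity) fun i => ?_
  refine (abs_sub_le_add (c := z.1 i) (d := z.2)).trans ?_
  have h1 : |w.1 i - z.1 i| ≤ dist z w := by
    rw [← Real.dist_eq, dist_comm]
    exact (dist_le_pi_dist _ _ i).trans (by rw [Prod.dist_eq]; exact le_max_left _ _)
  have h2 : |w.2 - z.2| ≤ dist z w := by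
    rw [← Real.dist_eq, dist_comm, Prod.dist_eq]; exact le_max_right _ _
  simp only [NNReal.coe_ofNat]
  linarith

lemma welfare_le_one {q : ℝ} (hq1 : q ≤ 1) {n : ℕ} (x : Fin n → ℝ) (y : ℝ) :
    welfare q x y ≤ 1 := by
  have h := welfare_le hq1 x y 0
  have h2 : empiricalTent x 0 y = 0 := by simp [empiricalTent]
  have h3 : (capacity q n / n : ℝ) ≤ 1 :=
    div_le_one_of_le₀ (by exact_mod_cast capacity_le hq1 n) n.cast_nonneg
  linarith

lemma bddAbove_welfare {q : ℝ} (hq1 : q ≤ 1) {n : ℕ} (x : Fin n → ℝ) :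
    BddAbove (range (welfare q x)) :=
  ⟨1, by rintro _ ⟨y, rfl⟩; exact welfare_le_one hq1 x y⟩

lemma welfare_le_optWelfare {q : ℝ} (hq1 : q ≤ 1) {n : ℕ} (x : Fin n → ℝ) (y : ℝ) :
    welfare q x y ≤ optWelfare q x :=
  le_ciSup (bddAbove_welfare hq1 x) y

lemma optWelfare_le_one {q : ℝ} (hq1 : q ≤ 1) {n : ℕ} (x : Fin n → ℝ) :
    optWelfare q x ≤ 1 :=
  ciSup_le fun y => welfare_le_one hq1 x y

lemma measurable_optWelfare {q : ℝ} (hq1 : q ≤ 1) (n : ℕ) :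
    Measurable fun x : Fin n → ℝ => optWelfare q x := by
  -- The supremum is over an uncountable set, so measurability is obtained from continuity.
  have : LipschitzWith 1 fun x : Fin n → ℝ => optWelfare q x := by
    refine LipschitzWith.of_le_add fun x x' => ciSup_le fun y => ?_
    refine (welfare_le_add (y' := y) hq1 dist_nonneg fun i => ?_).trans
      (add_le_add_left (welfare_le_optWelfare hq1 x' y) _)
    refine abs_sub_le_add.trans (add_le_add_right ?_ _)
    rw [sub_self, abs_zero, add_zero, ← Real.dist_eq, dist_comm]
    exact dist_le_pi_dist _ _ i
  exact this.continuous.measurable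

lemma welfare_nonneg {q : ℝ} {n : ℕ} {x : Fin n → ℝ} {y : ℝ}
    (h : ∀ i, |x i - y| ≤ 1) : 0 ≤ welfare q x y := by
  refine mul_nonneg (by positivity) (Finset.sum_nonneg fun i _ => ?_)
  rw [utility]
  split_ifs
  · linarith [h i]
  · exact le_rfl

lemma abs_sub_le_one {a b : ℝ} (ha : a ∈ Icc (0 : ℝ) 1) (hb : b ∈ Icc (0 : ℝ) 1) :
    |a - b| ≤ 1 :=
  abs_le.2 ⟨by linarith [ha.1, hb.2], by linarith [ha.2, hb.1]⟩

/-- Moving the facility to the nearest point of `[0,1]` does not decrease the welfare. -/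
lemma exists_mem_Icc_welfare_le {q : ℝ} (hq1 : q ≤ 1) {n : ℕ} {x : Fin n → ℝ}
    (hx : ∀ i, x i ∈ Icc (0 : ℝ) 1) (y : ℝ) :
    ∃ z ∈ Icc (0 : ℝ) 1, welfare q x y ≤ welfare q x z := by
  have key : ∃ z ∈ Icc (0 : ℝ) 1, ∀ a ∈ Icc (0 : ℝ) 1, |a - z| ≤ |a - y| := by
    rcases le_total y 0 with h | h
    · refine ⟨0, ⟨le_rfl, zero_le_one⟩, fun a ha => abs_le_abs_of_nonneg ?_ ?_⟩ <;> linarith [ha.1]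
    rcases le_total 1 y with h' | h'
    · refine ⟨1, ⟨zero_le_one, le_rfl⟩, fun a ha => abs_le_abs_of_nonpos ?_ ?_⟩ <;> linarith [ha.2]
    · exact ⟨y, ⟨h, h'⟩, fun _ _ => le_rfl⟩
  obtain ⟨z, hz, h⟩ := key
  refine ⟨z, hz, ?_⟩
  have := welfare_le_add (y := y) (y' := z) hq1 le_rfl fun i => by linarith [h _ (hx i)]
  linarith

/-! ### Order statistics -/

lemma floor_percentile_lt {p : ℝ} (hp : p ∈ Icc (0 : ℝ) 1) {n : ℕ} (hn : 0 < n) :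
    ⌊p * ((n : ℝ) - 1)⌋₊ < n := by
  have h1 : (1 : ℝ) ≤ n := by exact_mod_cast hn
  rw [Nat.floor_lt (mul_nonneg hp.1 (by linarith))]
  nlinarith [hp.2]

/-- Order statistics are expressed by counts, which makes them measurable and accessible to the law
of large numbers. -/
lemma apply_sort_le_iff {n : ℕ} (x : Fin n → ℝ) (j : Fin n) (a : ℝ) :
    x (Tuple.sort x j) ≤ a ↔ (j : ℝ) < ∑ i, (Iic a).indicator (fun _ => (1 : ℝ)) (x i) := by
  have h := Tuple.lt_card_le_iff_apply_le_of_monotone (f := x ∘ Tuple.sort x) (j := j) (a := a)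
    (Tuple.monotone_sort x)
  rw [← Equiv.sum_comp (Tuple.sort x)]
  simp only [Function.comp_apply] at h
  rw [← h]
  simp only [indicator_apply, mem_Iic, Finset.sum_boole, Nat.cast_lt]

lemma percentileMechanism_eq {p : ℝ} (hp : p ∈ Icc (0 : ℝ) 1) {n : ℕ} (hn : 0 < n)
    (x : Fin n → ℝ) :
    percentileMechanism p x =
      x (Tuple.sort x ⟨⌊p * ((n : ℝ) - 1)⌋₊, floor_percentile_lt hp hn⟩) := by
  rw [percentileMechanism, dif_pos (floor_percentile_lt hp hn)]

lemma percentileMechanism_mem {p : ℝ} {n : ℕ} {x : Fin n → ℝ}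
    (hx : ∀ i, x i ∈ Icc (0 : ℝ) 1) : percentileMechanism p x ∈ Icc (0 : ℝ) 1 := by
  rw [percentileMechanism]
  split_ifs
  · exact hx _
  · exact ⟨le_rfl, zero_le_one⟩

lemma measurable_percentileMechanism (p : ℝ) (n : ℕ) :
    Measurable fun x : Fin n → ℝ => percentileMechanism p x := by
  by_cases h : ⌊p * ((n : ℝ) - 1)⌋₊ < n
  · simp only [percentileMechanism, dif_pos h]
    refine measurable_of_Iic fun a => ?_
    have hm : Measurable fun x : Fin n → ℝ =>
        ∑ i, (Iic a).indicator (fun _ => (1 : ℝ)) (x i) :=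
      Finset.measurable_sum _ fun i _ => Measurable.comp
        (g := (Iic a).indicator fun _ => (1 : ℝ))
        (measurable_const.indicator measurableSet_Iic) (measurable_pi_apply i)
    have hs : (fun x : Fin n → ℝ => x (Tuple.sort x ⟨⌊p * ((n : ℝ) - 1)⌋₊, h⟩)) ⁻¹' Iic a =
        {x | (⌊p * ((n : ℝ) - 1)⌋₊ : ℝ) < ∑ i, (Iic a).indicator (fun _ => (1 : ℝ)) (x i)} := by
      ext x
      exact apply_sort_le_iff x _ a
    rw [hs]
    exact measurableSet_lt measurable_const hm
  · simp only [percentileMechanism, dif_neg h]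
    exact measurable_const

lemma measurable_welfare {q : ℝ} (hq1 : q ≤ 1) (n : ℕ) :
    Measurable fun z : (Fin n → ℝ) × ℝ => welfare q z.1 z.2 :=
  (lipschitzWith_welfare hq1 n).continuous.measurable

lemma measurable_prodMk_percentileMechanism (p : ℝ) (n : ℕ) :
    Measurable fun x : Fin n → ℝ => (x, percentileMechanism p x) :=
  Measurable.prodMk measurable_id (measurable_percentileMechanism p n)

lemma measurable_percentileWelfare {q : ℝ} (hq1 : q ≤ 1) (p : ℝ) (n : ℕ) :
    Measurable fun x : Fin n → ℝ => welfare q x (percentileMechanism p x) :=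
  Measurable.comp (g := fun z : (Fin n → ℝ) × ℝ => welfare q z.1 z.2)
    (f := fun x : Fin n → ℝ => (x, percentileMechanism p x))
    (measurable_welfare hq1 n) (measurable_prodMk_percentileMechanism p n)

/-! ### The limit problem -/

section Population

variable {μ : Measure ℝ} [IsProbabilityMeasure μ]

/-! ### The distribution function and the radius -/

lemma continuous_cdf [NullSingletonClass μ] : Continuous (cdf μ) := by
  refine continuous_iff_continuousAt.2 fun a => ?_
  rw [(monotone_cdf μ).continuousAt_iff_leftLim_eq_rightLim, StieltjesFunction.rightLim_eq]
  refine le_antisymm ((monotone_cdf μ).leftLim_le le_rfl) ?_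
  have h := (cdf μ).measure_singleton a
  rw [measure_cdf, measure_singleton, eq_comm, ENNReal.ofReal_eq_zero] at h
  linarith

lemma measureReal_Ioc_eq_cdf_sub {a b : ℝ} (h : a ≤ b) :
    μ.real (Ioc a b) = cdf μ b - cdf μ a := by
  rw [cdf_eq_real, cdf_eq_real, ← measureReal_sdiff (Iic_subset_Iic.2 h) measurableSet_Iic,
    Iic_sdiff_Iic]

lemma measureReal_Icc_eq_cdf_sub [NullSingletonClass μ] {a b : ℝ} (h : a ≤ b) :
    μ.real (Icc a b) = cdf μ b - cdf μ a := by
  rw [← measureReal_Ioc_eq_cdf_sub h]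
  exact (measureReal_congr Ioc_ae_eq_Icc).symm

/-- Without atoms the mass of the ball is continuous in `r`. It runs from `0` at `r = 0` to `1` at
`r = 1`, so solutions exist, and they form a closed set that contains its infimum. -/
lemma radius_spec [NullSingletonClass μ] (hsupp : μ (Icc (0 : ℝ) 1)ᶜ = 0) {q : ℝ} (hq0 : 0 ≤ q)
    (hq1 : q ≤ 1) {y : ℝ} (hy : y ∈ Icc (0 : ℝ) 1) :
    radius μ q y ∈ Icc (0 : ℝ) 1 ∧
      μ.real (Icc (y - radius μ q y) (y + radius μ q y)) = q := by
  have hset : {r : ℝ | r ∈ Icc (0 : ℝ) 1 ∧ μ.real (Icc (y - r) (y + r)) = q} =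
      Icc (0 : ℝ) 1 ∩ {r | cdf μ (y + r) - cdf μ (y - r) = q} := by
    ext r
    refine and_congr_right fun hr => ?_
    rw [measureReal_Icc_eq_cdf_sub (by linarith [hr.1])]
    rfl
  have hcont : Continuous fun r => cdf μ (y + r) - cdf μ (y - r) :=
    (continuous_cdf.comp (by fun_prop)).sub (continuous_cdf.comp (by fun_prop))
  have hclosed : IsClosed {r : ℝ | r ∈ Icc (0 : ℝ) 1 ∧ μ.real (Icc (y - r) (y + r)) = q} := by
    rw [hset]
    exact isClosed_Icc.inter (isClosed_eq hcont continuous_const)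
  refine hclosed.csInf_mem ?_ ⟨0, fun r hr => hr.1.1⟩
  rw [hset]
  have h1 : cdf μ (y + 1) - cdf μ (y - 1) = 1 := by
    rw [← measureReal_Icc_eq_cdf_sub (by linarith)]
    refine le_antisymm measureReal_le_one ?_
    have h : μ.real (Icc (0 : ℝ) 1) = 1 := by
      rw [measureReal_def, (prob_compl_eq_zero_iff measurableSet_Icc).1 hsupp, ENNReal.toReal_one]
    rw [← h]
    exact measureReal_mono (Icc_subset_Icc (by linarith [hy.2]) (by linarith [hy.1]))
  obtain ⟨r, hr, hr'⟩ := intermediate_value_Icc (zero_le_one' ℝ) hcont.continuousOn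
    (show q ∈ Icc _ _ by simp only [h1]; simpa using ⟨hq0, hq1⟩)
  exact ⟨r, hr, hr'⟩

/-- The mean of the tent function `(t - |x - y|)⁺`. -/
noncomputable def tent (μ : Measure ℝ) (t y : ℝ) : ℝ := ∫ x, max (t - |x - y|) 0 ∂μ

lemma abs_tent_le (t x y : ℝ) : |max (t - |x - y|) 0| ≤ |t| := by
  rw [abs_of_nonneg (le_max_right _ _)]
  exact max_le (by linarith [le_abs_self t, abs_nonneg (x - y)]) (abs_nonneg t)

lemma integrable_tent (t y : ℝ) : Integrable (fun x => max (t - |x - y|) 0) μ :=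
  .of_bound (by fun_prop) |t| (.of_forall fun x => by
    rw [Real.norm_eq_abs]; exact abs_tent_le t x y)

lemma ae_mem_Icc {μ : Measure ℝ} (hsupp : μ (Icc (0 : ℝ) 1)ᶜ = 0) : ∀ᵐ x ∂μ, x ∈ Icc (0 : ℝ) 1 :=
  hsupp

lemma integrable_abs_sub (hsupp : μ (Icc (0 : ℝ) 1)ᶜ = 0) (y : ℝ) :
    Integrable (fun x => |x - y|) μ := by
  refine .of_bound (by fun_prop) (1 + |y|) ?_
  filter_upwards [ae_mem_Icc hsupp] with x hx
  rw [Real.norm_eq_abs, abs_abs]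
  refine (abs_sub _ _).trans ?_
  rw [abs_of_nonneg hx.1]
  linarith [hx.2]

lemma tent_le_add {t t' y y' : ℝ} :
    tent μ t y ≤ tent μ t' y' + (|t - t'| + |y - y'|) := by
  have : tent μ t' y' + (|t - t'| + |y - y'|) =
      ∫ x, (max (t' - |x - y'|) 0 + (|t - t'| + |y - y'|)) ∂μ := by
    rw [integral_add (integrable_tent _ _) (integrable_const _)]
    simp [tent]
  rw [this]
  refine integral_mono (integrable_tent _ _) ((integrable_tent _ _).add (integrable_const _))
    fun x => ?_
  refine max_le ?_ (add_nonneg (le_max_right _ _) (by positivity))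
  have h1 := abs_sub_le_add (a := x) (b := y') (c := x) (d := y)
  rw [sub_self, abs_zero, zero_add, abs_sub_comm y'] at h1
  linarith [le_max_left (t' - |x - y'|) 0, le_abs_self (t - t')]

/-- A set of mass `q` bounds the tent function from below. -/
lemma mul_sub_setIntegral_le_tent (hsupp : μ (Icc (0 : ℝ) 1)ᶜ = 0) {q : ℝ} {B : Set ℝ}
    (hBq : μ.real B = q) (t z : ℝ) : q * t - ∫ x in B, |x - z| ∂μ ≤ tent μ t z := by
  have h1 : ∫ x in B, (t - |x - z|) ∂μ = q * t - ∫ x in B, |x - z| ∂μ := by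
    rw [integral_sub (integrable_const _) (integrable_abs_sub hsupp z).integrableOn]
    simp [hBq]
  rw [← h1]
  calc ∫ x in B, (t - |x - z|) ∂μ ≤ ∫ x in B, max (t - |x - z|) 0 ∂μ :=
        integral_mono ((integrable_const _).sub (integrable_abs_sub hsupp z).integrableOn)
          (integrable_tent _ _).integrableOn fun x => le_max_left _ _
    _ ≤ tent μ t z := setIntegral_le_integral (integrable_tent _ _)
        (.of_forall fun x => le_max_right _ _)

/-! ### Moving the centre with the set of integration fixed -/

lemma setIntegral_const_add_indicator (B : Set ℝ) (a c d : ℝ) :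
    ∫ x in B, (c + (Iic a).indicator (fun _ => d) x) ∂μ =
      c * μ.real B + d * μ.real (Iic a ∩ B) := by
  rw [integral_add (integrable_const _) ((integrable_const _).indicator measurableSet_Iic),
    integral_indicator measurableSet_Iic, Measure.restrict_restrict measurableSet_Iic]
  simp [mul_comm]

lemma integrable_const_add_indicator (B : Set ℝ) (a c d : ℝ) :
    Integrable (fun x => c + (Iic a).indicator (fun _ => d) x) (μ.restrict B) :=
  (integrable_const _).add ((integrable_const _).indicator measurableSet_Iic)

/-- Moving the centre from `v` to `w` saves exactly `w - v` for points beyond `w` and costs at most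
`w - v` for all others. -/
lemma setIntegral_abs_sub_right_le (hsupp : μ (Icc (0 : ℝ) 1)ᶜ = 0) (B : Set ℝ) {v w : ℝ}
    (h : v ≤ w) : ∫ x in B, |x - w| ∂μ ≤
      ∫ x in B, |x - v| ∂μ + (w - v) * (2 * μ.real (Iic w ∩ B) - μ.real B) := by
  have hi := (integrable_abs_sub hsupp v).integrableOn (s := B)
  have hj := integrable_const_add_indicator (μ := μ) B w (-(w - v)) (2 * (w - v))
  calc ∫ x in B, |x - w| ∂μ
      ≤ ∫ x in B, (|x - v| + (-(w - v) + (Iic w).indicator (fun _ => 2 * (w - v)) x)) ∂μ := by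
        refine integral_mono (integrable_abs_sub hsupp w).integrableOn (hi.add hj) fun x => ?_
        by_cases hx : x ∈ Iic w
        · have := abs_sub_le x v w
          rw [abs_sub_comm v w, abs_of_nonneg (sub_nonneg.2 h)] at this
          simp only [indicator_of_mem hx]
          linarith
        · have hx' : w < x := not_le.1 hx
          simp only [indicator_of_notMem hx]
          rw [abs_of_nonneg (by linarith), abs_of_nonneg (by linarith)]
          linarith
    _ = _ := by
        rw [integral_add hi hj, setIntegral_const_add_indicator]
        ring

lemma setIntegral_abs_sub_left_le (hsupp : μ (Icc (0 : ℝ) 1)ᶜ = 0) (B : Set ℝ) {v w : ℝ}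
    (h : v ≤ w) : ∫ x in B, |x - v| ∂μ ≤
      ∫ x in B, |x - w| ∂μ + (w - v) * (μ.real B - 2 * μ.real (Iic v ∩ B)) := by
  have hi := (integrable_abs_sub hsupp w).integrableOn (s := B)
  have hj := integrable_const_add_indicator (μ := μ) B v (w - v) (-(2 * (w - v)))
  calc ∫ x in B, |x - v| ∂μ
      ≤ ∫ x in B, (|x - w| + ((w - v) + (Iic v).indicator (fun _ => -(2 * (w - v))) x)) ∂μ := by
        refine integral_mono (integrable_abs_sub hsupp v).integrableOn (hi.add hj) fun x => ?_
        by_cases hx : x ∈ Iic v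
        · have hx' : x ≤ v := hx
          simp only [indicator_of_mem hx]
          rw [abs_of_nonpos (by linarith), abs_of_nonpos (by linarith)]
          linarith
        · have := abs_sub_le x w v
          rw [abs_of_nonneg (sub_nonneg.2 h)] at this
          simp only [indicator_of_notMem hx]
          linarith
    _ = _ := by
        rw [integral_add hi hj, setIntegral_const_add_indicator]
        ring

lemma measureReal_Iic_inter_le (B : Set ℝ) {v w : ℝ} (h : v ≤ w) :
    μ.real (Iic w ∩ B) ≤ μ.real (Iic v ∩ B) + (cdf μ w - cdf μ v) := by
  rw [← measureReal_Ioc_eq_cdf_sub h]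
  refine (measureReal_mono ?_).trans (measureReal_union_le _ _)
  rintro x ⟨hx, hxB⟩
  rcases le_or_gt x v with h' | h'
  · exact Or.inl ⟨h', hxB⟩
  · exact Or.inr ⟨h', hx⟩

/-! ### Duality for the cost -/

variable [NullSingletonClass μ] {q : ℝ}

lemma mul_sub_cost_le_tent (hsupp : μ (Icc (0 : ℝ) 1)ᶜ = 0) (hq0 : 0 ≤ q) (hq1 : q ≤ 1)
    {y : ℝ} (hy : y ∈ Icc (0 : ℝ) 1) (t : ℝ) : q * t - cost μ q y ≤ tent μ t y :=
  mul_sub_setIntegral_le_tent hsupp (radius_spec hsupp hq0 hq1 hy).2 t y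

/-- At height `r` the tent is positive only inside the ball of radius `r`, so the bound by a set of
mass `q` becomes an equality. -/
lemma tent_radius_eq (hsupp : μ (Icc (0 : ℝ) 1)ᶜ = 0) (hq0 : 0 ≤ q) (hq1 : q ≤ 1)
    {y : ℝ} (hy : y ∈ Icc (0 : ℝ) 1) :
    tent μ (radius μ q y) y = q * radius μ q y - cost μ q y := by
  set r := radius μ q y with hr
  have hq := (radius_spec hsupp hq0 hq1 hy).2
  rw [← hr] at hq
  have h1 : ∫ x in Icc (y - r) (y + r), (r - |x - y|) ∂μ = q * r - cost μ q y := by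
    rw [integral_sub (integrable_const _) (integrable_abs_sub hsupp y).integrableOn, cost, ← hr]
    simp [hq]
  rw [← h1, tent, ← integral_indicator measurableSet_Icc]
  congr 1
  ext x
  by_cases hx : x ∈ Icc (y - r) (y + r)
  · rw [indicator_of_mem hx, max_eq_left]
    rw [sub_nonneg, abs_le]
    exact ⟨by linarith [hx.1], by linarith [hx.2]⟩
  · rw [indicator_of_notMem hx, max_eq_right]
    by_contra! h
    have := abs_lt.1 (sub_pos.1 h)
    exact hx ⟨by linarith, by linarith⟩

/-- Among sets of mass `q`, the ball is the cheapest to serve from its centre: compare both at the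
dual parameter `t = radius μ q z`. -/
lemma cost_le_setIntegral (hsupp : μ (Icc (0 : ℝ) 1)ᶜ = 0) (hq0 : 0 ≤ q) (hq1 : q ≤ 1)
    {z : ℝ} (hz : z ∈ Icc (0 : ℝ) 1) {B : Set ℝ} (hBq : μ.real B = q) :
    cost μ q z ≤ ∫ x in B, |x - z| ∂μ := by
  have h1 := mul_sub_setIntegral_le_tent hsupp hBq (radius μ q z) z
  rw [tent_radius_eq hsupp hq0 hq1 hz] at h1
  linarith

/-- Using the radius at `z` as dual parameter for both points avoids any regularity of the radius in
its centre. -/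
lemma cost_le_cost_add (hsupp : μ (Icc (0 : ℝ) 1)ᶜ = 0) (hq0 : 0 ≤ q) (hq1 : q ≤ 1)
    {y z : ℝ} (hy : y ∈ Icc (0 : ℝ) 1) (hz : z ∈ Icc (0 : ℝ) 1) :
    cost μ q z ≤ cost μ q y + |z - y| := by
  have h1 := tent_radius_eq hsupp hq0 hq1 hz
  have h2 := mul_sub_cost_le_tent hsupp hq0 hq1 hy (radius μ q z)
  have h3 := tent_le_add (μ := μ) (t := radius μ q z) (t' := radius μ q z) (y := y) (y' := z)
  rw [sub_self, abs_zero, zero_add, abs_sub_comm] at h3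
  linarith

lemma continuousOn_cost (hsupp : μ (Icc (0 : ℝ) 1)ᶜ = 0) (hq0 : 0 ≤ q) (hq1 : q ≤ 1) :
    ContinuousOn (cost μ q) (Icc (0 : ℝ) 1) := by
  have : LipschitzOnWith 1 (cost μ q) (Icc (0 : ℝ) 1) :=
    LipschitzOnWith.of_le_add fun z hz y hy => by
      rw [Real.dist_eq]; exact cost_le_cost_add hsupp hq0 hq1 hy hz
  exact this.continuousOn

lemma exists_isMinOn_cost (hsupp : μ (Icc (0 : ℝ) 1)ᶜ = 0) (hq0 : 0 ≤ q) (hq1 : q ≤ 1) :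
    ∃ y ∈ Icc (0 : ℝ) 1, IsMinOn (cost μ q) (Icc (0 : ℝ) 1) y :=
  isCompact_Icc.exists_isMinOn ⟨0, le_rfl, zero_le_one⟩ (continuousOn_cost hsupp hq0 hq1)

/-- This keeps the limit of the approximation ratio's denominator positive. The utility `1 - |x -
y|` can vanish on `[0,1]` only at the endpoints, which are null. -/
lemma cost_lt (hsupp : μ (Icc (0 : ℝ) 1)ᶜ = 0) (hq0 : 0 < q) (hq1 : q ≤ 1)
    {y : ℝ} (hy : y ∈ Icc (0 : ℝ) 1) : cost μ q y < q := by
  have hq := (radius_spec hsupp hq0.le hq1 hy).2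
  set B := Icc (y - radius μ q y) (y + radius μ q y) with hB
  have hi : Integrable (fun x => 1 - |x - y|) (μ.restrict B) :=
    (integrable_const _).sub (integrable_abs_sub hsupp y).integrableOn
  have h1 : ∫ x in B, (1 - |x - y|) ∂μ = q - cost μ q y := by
    rw [integral_sub (integrable_const _) (integrable_abs_sub hsupp y).integrableOn, cost, ← hB]
    simp [hq]
  have hae : ∀ᵐ x ∂μ, 0 < 1 - |x - y| := by
    have h0 : ∀ᵐ x ∂μ, x ≠ 0 := by simp [ae_iff]
    have h1 : ∀ᵐ x ∂μ, x ≠ 1 := by simp [ae_iff]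
    filter_upwards [ae_mem_Icc hsupp, h0, h1] with x hx hx0 hx1
    rw [sub_pos, abs_lt]
    exact ⟨by linarith [hx.1.lt_of_ne' hx0, hy.2], by linarith [hx.2.lt_of_ne hx1, hy.1]⟩
  have h2 : 0 < ∫ x in B, (1 - |x - y|) ∂μ := by
    rw [integral_pos_iff_support_of_nonneg_ae
      ((ae_restrict_of_ae hae).mono fun x hx => hx.le) hi]
    have : (Function.support fun x => 1 - |x - y|) =ᵐ[μ.restrict B] univ := by
      refine eventuallyEq_univ.2 ((ae_restrict_of_ae hae).mono fun x hx => ?_)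
      exact hx.ne'
    rw [measure_congr this, Measure.restrict_apply_univ]
    refine pos_iff_ne_zero.2 fun h => ?_
    rw [measureReal_def, h] at hq
    simp at hq
    exact hq0.ne hq
  linarith

/-! ### Minimizers on a fixed set are medians -/

section Flat

variable {y : ℝ} {B : Set ℝ}

/-- First-order condition from the right: no `w > y` improves on `y`, and `w ↓ y` turns the
one-sided estimate into half of the median property. At `y = 1` almost all of `B` lies to the left.
-/
lemma le_two_mul_measureReal_Iic (hsupp : μ (Icc (0 : ℝ) 1)ᶜ = 0)
    (hy : y ∈ Icc (0 : ℝ) 1)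
    (hmin : ∀ w ∈ Icc (0 : ℝ) 1, ∫ x in B, |x - y| ∂μ ≤ ∫ x in B, |x - w| ∂μ) :
    μ.real B ≤ 2 * μ.real (Iic y ∩ B) := by
  rcases hy.2.eq_or_lt with rfl | hy1
  · have : (Iic 1 ∩ B : Set ℝ) =ᵐ[μ] B := by
      filter_upwards [ae_mem_Icc hsupp] with x hx
      exact propext ⟨fun h => h.2, fun h => ⟨hx.2, h⟩⟩
    rw [measureReal_congr this]
    linarith [measureReal_nonneg (μ := μ) (s := B)]
  · have hlim : Tendsto (fun w => 2 * (μ.real (Iic y ∩ B) + (cdf μ w - cdf μ y))) (𝓝[>] y)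
        (𝓝 (2 * (μ.real (Iic y ∩ B) + (cdf μ y - cdf μ y)))) :=
      (((continuous_cdf.tendsto y).mono_left nhdsWithin_le_nhds).sub_const _
        |>.const_add _).const_mul _
    rw [sub_self, add_zero] at hlim
    refine ge_of_tendsto hlim ?_
    filter_upwards [Ioo_mem_nhdsGT hy1] with w hw
    have h1 := hmin w ⟨hy.1.trans hw.1.le, hw.2.le⟩
    have h2 := setIntegral_abs_sub_right_le hsupp B hw.1.le
    have h3 := measureReal_Iic_inter_le (μ := μ) B hw.1.le
    have h4 : 0 ≤ 2 * μ.real (Iic w ∩ B) - μ.real B :=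
      nonneg_of_mul_nonneg_right (by linarith) (sub_pos.2 hw.1)
    linarith

lemma two_mul_measureReal_Iic_le (hsupp : μ (Icc (0 : ℝ) 1)ᶜ = 0)
    (hy : y ∈ Icc (0 : ℝ) 1)
    (hmin : ∀ w ∈ Icc (0 : ℝ) 1, ∫ x in B, |x - y| ∂μ ≤ ∫ x in B, |x - w| ∂μ) :
    2 * μ.real (Iic y ∩ B) ≤ μ.real B := by
  rcases hy.1.eq_or_lt with rfl | hy0
  · have h0 : ∀ᵐ x ∂μ, x ≠ 0 := by simp [ae_iff]
    have : (Iic 0 ∩ B : Set ℝ) =ᵐ[μ] (∅ : Set ℝ) := by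
      filter_upwards [ae_mem_Icc hsupp, h0] with x hx hx0
      exact propext ⟨fun h => hx0 (le_antisymm h.1 hx.1), fun h => h.elim⟩
    rw [measureReal_congr this, measureReal_empty, mul_zero]
    exact measureReal_nonneg
  · have hlim : Tendsto (fun w => 2 * (μ.real (Iic y ∩ B) - (cdf μ y - cdf μ w))) (𝓝[<] y)
        (𝓝 (2 * (μ.real (Iic y ∩ B) - (cdf μ y - cdf μ y)))) :=
      (((continuous_cdf.tendsto y).mono_left nhdsWithin_le_nhds).const_sub _
        |>.const_sub _).const_mul _
    rw [sub_self, sub_zero] at hlim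
    refine le_of_tendsto hlim ?_
    filter_upwards [Ioo_mem_nhdsLT hy0] with w hw
    have h1 := hmin w ⟨hw.1.le, hw.2.le.trans hy.2⟩
    have h2 := setIntegral_abs_sub_left_le hsupp B hw.2.le
    have h3 := measureReal_Iic_inter_le (μ := μ) B hw.2.le
    have h4 : 0 ≤ μ.real B - 2 * μ.real (Iic w ∩ B) :=
      nonneg_of_mul_nonneg_right (by linarith) (sub_pos.2 hw.2)
    linarith

/-- No mass lies between `y` and `z`, so `z` inherits the median inequality that makes the
first-order term nonpositive. -/
lemma setIntegral_abs_sub_le_of_cdf_eq (hsupp : μ (Icc (0 : ℝ) 1)ᶜ = 0)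
    (hy : y ∈ Icc (0 : ℝ) 1)
    (hmin : ∀ w ∈ Icc (0 : ℝ) 1, ∫ x in B, |x - y| ∂μ ≤ ∫ x in B, |x - w| ∂μ)
    {z : ℝ} (hz : cdf μ z = cdf μ y) :
    ∫ x in B, |x - z| ∂μ ≤ ∫ x in B, |x - y| ∂μ := by
  rcases le_total z y with h | h
  · have h1 := setIntegral_abs_sub_left_le hsupp B h
    have h2 := measureReal_Iic_inter_le (μ := μ) B h
    have h3 := le_two_mul_measureReal_Iic hsupp hy hmin
    have h4 : (y - z) * (μ.real B - 2 * μ.real (Iic z ∩ B)) ≤ 0 :=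
      mul_nonpos_of_nonneg_of_nonpos (by linarith) (by linarith)
    linarith
  · have h1 := setIntegral_abs_sub_right_le hsupp B h
    have h2 := measureReal_Iic_inter_le (μ := μ) B h
    have h3 := two_mul_measureReal_Iic_le hsupp hy hmin
    have h4 : (z - y) * (2 * μ.real (Iic z ∩ B) - μ.real B) ≤ 0 :=
      mul_nonpos_of_nonneg_of_nonpos (by linarith) (by linarith)
    linarith

end Flat

/-- The cost is constant on the part of a level set of the distribution function
that contains a minimizer. -/
lemma cost_eq_of_cdf_eq (hsupp : μ (Icc (0 : ℝ) 1)ᶜ = 0) (hq0 : 0 ≤ q) (hq1 : q ≤ 1)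
    {y z : ℝ} (hy : y ∈ Icc (0 : ℝ) 1) (hmin : IsMinOn (cost μ q) (Icc (0 : ℝ) 1) y)
    (hz : z ∈ Icc (0 : ℝ) 1) (hyz : cdf μ z = cdf μ y) : cost μ q z = cost μ q y := by
  refine le_antisymm ?_ (hmin hz)
  -- Freeze the ball around `y`. The integral over it centred at `w` is at least the cost at `w`,
  -- with equality at `y`, so `y` also minimizes the frozen problem.
  have hB := (radius_spec hsupp hq0 hq1 hy).2
  refine (cost_le_setIntegral hsupp hq0 hq1 hz hB).trans
    (setIntegral_abs_sub_le_of_cdf_eq hsupp hy (fun w hw => ?_) hyz)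
  exact (hmin hw).trans (cost_le_setIntegral hsupp hq0 hq1 hw hB)

end Population

/-! ### Typical sequences of agents -/

/-- The positions of the first `n` agents of a sequence. -/
def initial (x : ℕ → ℝ) (n : ℕ) : Fin n → ℝ := fun i => x i

/-- The sequences in `[0,1]` whose empirical averages converge for all rational tent functions and
all rational half-lines. -/
structure IsTypical (μ : Measure ℝ) (x : ℕ → ℝ) : Prop where
  mem_Icc : ∀ i, x i ∈ Icc (0 : ℝ) 1
  tendsto_tent : ∀ t y : ℚ,
    Tendsto (fun n => empiricalTent (initial x n) t y) atTop (𝓝 (tent μ t y))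
  tendsto_cdf : ∀ s : ℚ, Tendsto (fun n : ℕ => (1 / (n : ℝ)) *
    ∑ i, (Iic (s : ℝ)).indicator (fun _ => (1 : ℝ)) (initial x n i)) atTop (𝓝 (cdf μ s))

lemma tendsto_capacity_div {q : ℝ} (hq0 : 0 ≤ q) :
    Tendsto (fun n : ℕ => (capacity q n : ℝ) / n) atTop (𝓝 q) :=
  (tendsto_nat_floor_mul_div_atTop hq0).comp tendsto_natCast_atTop_atTop

lemma abs_sub_floor_mul_div_le {N : ℕ} (hN : 0 < N) {t : ℝ} (ht : 0 ≤ t) :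
    |t - (⌊t * N⌋₊ : ℝ) / N| ≤ 1 / N := by
  have hN' : (0 : ℝ) < N := by exact_mod_cast hN
  have h1 := Nat.floor_le (mul_nonneg ht hN'.le)
  have h2 := Nat.lt_floor_add_one (t * N)
  rw [abs_le]
  constructor
  · have : (⌊t * N⌋₊ : ℝ) / N ≤ t := (div_le_iff₀ hN').2 h1
    have : (0 : ℝ) ≤ 1 / N := by positivity
    linarith
  · have : t ≤ (⌊t * N⌋₊ + 1 : ℝ) / N := (le_div_iff₀ hN').2 h2.le
    rw [add_div] at this
    linarith

lemma empiricalTent_le_empiricalTent_add {n : ℕ} (x : Fin n → ℝ) (t t' y y' : ℝ) :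
    empiricalTent x t y ≤ empiricalTent x t' y' + (|t - t'| + |y - y'|) := by
  refine empiricalTent_le_add (by positivity) fun i => ?_
  have h := abs_sub_le_add (a := x i) (b := y') (c := x i) (d := y)
  rw [sub_self, abs_zero, zero_add, abs_sub_comm y'] at h
  linarith [le_abs_self (t - t')]

variable {μ : Measure ℝ} [IsProbabilityMeasure μ] {x : ℕ → ℝ} {q : ℝ}

lemma IsTypical.eventually_abs_tent_sub_le (hx : IsTypical μ x) {ε : ℝ} (hε : 0 < ε) :
    ∀ᶠ n in atTop, ∀ t ∈ Icc (0 : ℝ) 1, ∀ y ∈ Icc (0 : ℝ) 1,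
      |empiricalTent (initial x n) t y - tent μ t y| ≤ ε := by
  -- Rounding `t` and `y` down to the grid moves each by at most `1 / N ≤ ε / 8`. This changes both
  -- tent averages by at most `ε / 4`, which leaves `ε / 2` for the error at the grid points.
  obtain ⟨N, hN⟩ := exists_nat_gt (8 / ε)
  have hN0 : (0 : ℝ) < N := lt_trans (by positivity) hN
  have hNε : 1 / (N : ℝ) ≤ ε / 8 := by
    rw [div_lt_iff₀ hε] at hN
    rw [div_le_iff₀ hN0]
    linarith
  have hgrid : ∀ᶠ n in atTop, ∀ a ∈ Finset.range (N + 1), ∀ b ∈ Finset.range (N + 1),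
      |empiricalTent (initial x n) ((a : ℝ) / N) ((b : ℝ) / N) - tent μ ((a : ℝ) / N) ((b : ℝ) / N)|
        < ε / 2 := by
    simp only [Finset.eventually_all]
    intro a _ b _
    have := hx.tendsto_tent ((a : ℚ) / N) ((b : ℚ) / N)
    push_cast at this
    have := (Metric.tendsto_nhds.1 this) (ε / 2) (by positivity)
    simpa only [Real.dist_eq] using this
  have hmem : ∀ t ∈ Icc (0 : ℝ) 1, ⌊t * N⌋₊ ∈ Finset.range (N + 1) := by
    intro t ht
    rw [Finset.mem_range, Nat.lt_succ_iff]
    exact Nat.floor_le_of_le (by nlinarith [ht.2])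
  filter_upwards [hgrid] with n hn t ht y hy
  have h0 := abs_le.1 (hn _ (hmem t ht) _ (hmem y hy)).le
  have ht' := abs_sub_floor_mul_div_le (N := N) (by exact_mod_cast hN0) ht.1
  have hy' := abs_sub_floor_mul_div_le (N := N) (by exact_mod_cast hN0) hy.1
  set t' := (⌊t * N⌋₊ : ℝ) / N
  set y' := (⌊y * N⌋₊ : ℝ) / N
  have h1 := empiricalTent_le_empiricalTent_add (initial x n) t t' y y'
  have h2 := empiricalTent_le_empiricalTent_add (initial x n) t' t y' y
  have h3 := tent_le_add (μ := μ) (t := t) (t' := t') (y := y) (y' := y')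
  have h4 := tent_le_add (μ := μ) (t := t') (t' := t) (y := y') (y' := y)
  rw [abs_sub_comm t' t, abs_sub_comm y' y] at h2 h4
  rw [abs_le]
  constructor <;> linarith [h0.1, h0.2]

/-! ### Convergence of the welfare along typical sequences -/

section Convergence

variable [NullSingletonClass μ]

/-- Each bound uses the optimal `t` of one problem as a trial parameter in the other: the empirical
one from below, the radius from above. Both lie in `[0,1]`, where tent averages converge uniformly.
-/
lemma IsTypical.eventually_abs_welfare_sub_le (hx : IsTypical μ x)
    (hsupp : μ (Icc (0 : ℝ) 1)ᶜ = 0) (hq0 : 0 ≤ q) (hq1 : q ≤ 1) {ε : ℝ} (hε : 0 < ε) :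
    ∀ᶠ n in atTop, ∀ y ∈ Icc (0 : ℝ) 1,
      |welfare q (initial x n) y - (q - cost μ q y)| ≤ ε := by
  filter_upwards [hx.eventually_abs_tent_sub_le (half_pos hε),
    Metric.tendsto_nhds.1 (tendsto_capacity_div hq0) (ε / 2) (half_pos hε)] with n hn hκ y hy
  rw [Real.dist_eq] at hκ
  set κ := (capacity q n : ℝ) / n with hκdef
  have hbound : ∀ t ∈ Icc (0 : ℝ) 1, |(κ - q) * (1 - t)| ≤ ε / 2 := by
    intro t ht
    rw [abs_mul, abs_of_nonneg (sub_nonneg.2 ht.2)]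
    nlinarith [ht.1, ht.2, abs_nonneg (κ - q)]
  rw [abs_le]
  constructor
  · obtain ⟨t, ht0, ht1, ht⟩ := exists_welfare_eq hq1 (initial x n) y
    have htm : t ∈ Icc (0 : ℝ) 1 := ⟨ht0, ht1 fun i => abs_sub_le_one (hx.mem_Icc _) hy⟩
    have h1 := abs_le.1 (hn t htm y hy)
    have h2 := abs_le.1 (hbound t htm)
    have h3 := mul_sub_cost_le_tent hsupp hq0 hq1 hy t
    rw [← hκdef] at ht
    linarith [h1.1, h2.1]
  · have hr := (radius_spec hsupp hq0 hq1 hy).1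
    have h1 := abs_le.1 (hn _ hr y hy)
    have h2 := abs_le.1 (hbound _ hr)
    have h3 := tent_radius_eq hsupp hq0 hq1 hy
    have h4 := welfare_le hq1 (initial x n) y (radius μ q y)
    rw [← hκdef] at h4
    linarith [h1.2, h2.2]

lemma IsTypical.tendsto_optWelfare (hx : IsTypical μ x)
    (hsupp : μ (Icc (0 : ℝ) 1)ᶜ = 0) (hq0 : 0 ≤ q) (hq1 : q ≤ 1) {y : ℝ}
    (hy : y ∈ Icc (0 : ℝ) 1) (hmin : IsMinOn (cost μ q) (Icc (0 : ℝ) 1) y) :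
    Tendsto (fun n => optWelfare q (initial x n)) atTop (𝓝 (q - cost μ q y)) := by
  rw [Metric.tendsto_nhds]
  intro ε hε
  filter_upwards [hx.eventually_abs_welfare_sub_le hsupp hq0 hq1 (half_pos hε)] with n hn
  rw [Real.dist_eq]
  refine lt_of_le_of_lt (abs_le.2 ⟨?_, ?_⟩) (half_lt_self hε)
  · linarith [(abs_le.1 (hn y hy)).1, welfare_le_optWelfare hq1 (initial x n) y]
  · have : optWelfare q (initial x n) ≤ q - cost μ q y + ε / 2 := by
      refine ciSup_le fun w => ?_
      obtain ⟨z, hz, hwz⟩ := exists_mem_Icc_welfare_le hq1 (x := initial x n)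
        (fun i => hx.mem_Icc _) w
      have h : cost μ q y ≤ cost μ q z := hmin hz
      linarith [(abs_le.1 (hn z hz)).2]
    linarith

/-- The limit is squeezed between rationals, at which the empirical distribution function converges.
Subsequences are allowed because the full sequence may oscillate over a flat piece. -/
lemma IsTypical.cdf_eq_of_tendsto (hx : IsTypical μ x) {p : ℝ} (hp : p ∈ Icc (0 : ℝ) 1)
    {m : ℕ → ℕ} (hm : Tendsto m atTop atTop) {z : ℝ}
    (hz : Tendsto (fun k => percentileMechanism p (initial x (m k))) atTop (𝓝 z)) :
    cdf μ z = p := by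
  have hpos : ∀ᶠ k in atTop, 0 < m k := hm.eventually_gt_atTop 0
  have hleft : ∀ s : ℚ, (s : ℝ) < z → cdf μ s ≤ p := by
    intro s hs
    refine le_of_tendsto ((hx.tendsto_cdf s).comp hm) ?_
    filter_upwards [hpos, hz.eventually_const_lt hs] with k hk hlt
    rw [percentileMechanism_eq hp hk, ← not_le, apply_sort_le_iff, not_lt] at hlt
    have hk' : (1 : ℝ) ≤ m k := by exact_mod_cast hk
    have h1 := Nat.floor_le (mul_nonneg hp.1 (sub_nonneg.2 hk'))
    simp only [Function.comp_apply]
    rw [one_div_mul_eq_div, div_le_iff₀ (by linarith)]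
    refine hlt.trans (h1.trans ?_)
    nlinarith [hp.1]
  have hright : ∀ s : ℚ, z < s → p ≤ cdf μ s := by
    intro s hs
    -- The count exceeds `⌊p (m - 1)⌋ > p m - p - 1 ≥ p m - 2`; hence the `2`.
    have hlim : Tendsto (fun k => p - 2 / (m k : ℝ)) atTop (𝓝 (p - 0)) :=
      ((tendsto_natCast_atTop_atTop.comp hm).const_div_atTop 2).const_sub p
    rw [sub_zero] at hlim
    refine le_of_tendsto_of_tendsto hlim ((hx.tendsto_cdf s).comp hm) ?_
    filter_upwards [hpos, hz.eventually_lt_const hs] with k hk hlt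
    have hle := hlt.le
    rw [percentileMechanism_eq hp hk, apply_sort_le_iff] at hle
    have hk' : (1 : ℝ) ≤ m k := by exact_mod_cast hk
    have h1 := Nat.lt_floor_add_one (p * ((m k : ℝ) - 1))
    simp only [Function.comp_apply]
    rw [one_div_mul_eq_div, le_div_iff₀ (by linarith), sub_mul, div_mul_cancel₀ _ (by linarith)]
    simp only at hle
    linarith [hp.2]
  have hc : ContinuousAt (cdf μ) z := continuous_cdf.continuousAt
  refine le_antisymm ?_ ?_
  · by_contra! h
    obtain ⟨l, hl, hlz⟩ := (mem_nhdsLT_iff_exists_Ioo_subset).1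
      (nhdsWithin_le_nhds (hc.eventually_const_lt h))
    obtain ⟨s, hs1, hs2⟩ := exists_rat_btwn (mem_Iio.1 hl)
    exact absurd (hleft s hs2) (not_le.2 (hlz ⟨hs1, hs2⟩))
  · by_contra! h
    obtain ⟨l, hl, hlz⟩ := (mem_nhdsGT_iff_exists_Ioo_subset).1
      (nhdsWithin_le_nhds (hc.eventually_lt_const h))
    obtain ⟨s, hs1, hs2⟩ := exists_rat_btwn (mem_Ioi.1 hl)
    exact absurd (hright s hs1) (not_le.2 (hlz ⟨hs1, hs2⟩))

lemma IsTypical.tendsto_cost_percentileMechanism (hx : IsTypical μ x)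
    (hsupp : μ (Icc (0 : ℝ) 1)ᶜ = 0) (hq0 : 0 ≤ q) (hq1 : q ≤ 1) {y : ℝ}
    (hy : y ∈ Icc (0 : ℝ) 1) (hmin : IsMinOn (cost μ q) (Icc (0 : ℝ) 1) y) :
    Tendsto (fun n => cost μ q (percentileMechanism (cdf μ y) (initial x n))) atTop
      (𝓝 (cost μ q y)) := by
  refine tendsto_of_subseq_tendsto fun ns hns => ?_
  have hmem : ∀ n, percentileMechanism (cdf μ y) (initial x n) ∈ Icc (0 : ℝ) 1 := fun n =>
    percentileMechanism_mem fun i => hx.mem_Icc _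
  obtain ⟨z, hz, φ, hφ, hlim⟩ := isCompact_Icc.tendsto_subseq fun k => hmem (ns k)
  have hcdf := hx.cdf_eq_of_tendsto ⟨cdf_nonneg μ y, cdf_le_one μ y⟩
    (hns.comp hφ.tendsto_atTop) hlim
  refine ⟨φ, ?_⟩
  rw [← cost_eq_of_cdf_eq hsupp hq0 hq1 hy hmin hz hcdf]
  exact (continuousOn_cost hsupp hq0 hq1 z hz).tendsto.comp
    (tendsto_nhdsWithin_iff.2 ⟨hlim, .of_forall fun k => hmem _⟩)

lemma IsTypical.tendsto_percentileWelfare (hx : IsTypical μ x)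
    (hsupp : μ (Icc (0 : ℝ) 1)ᶜ = 0) (hq0 : 0 ≤ q) (hq1 : q ≤ 1) {y : ℝ}
    (hy : y ∈ Icc (0 : ℝ) 1) (hmin : IsMinOn (cost μ q) (Icc (0 : ℝ) 1) y) :
    Tendsto (fun n => welfare q (initial x n) (percentileMechanism (cdf μ y) (initial x n)))
      atTop (𝓝 (q - cost μ q y)) := by
  have hc := (hx.tendsto_cost_percentileMechanism hsupp hq0 hq1 hy hmin).const_sub q
  rw [Metric.tendsto_nhds] at hc ⊢
  intro ε hε
  filter_upwards [hc (ε / 2) (half_pos hε),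
    hx.eventually_abs_welfare_sub_le hsupp hq0 hq1 (half_pos hε)] with n h1 h2
  have h3 := h2 _ (percentileMechanism_mem (p := cdf μ y) (x := initial x n) fun i => hx.mem_Icc _)
  rw [← Real.dist_eq] at h3
  linarith [dist_triangle (welfare q (initial x n) (percentileMechanism (cdf μ y) (initial x n)))
    (q - cost μ q (percentileMechanism (cdf μ y) (initial x n))) (q - cost μ q y)]

end Convergence

/-! ### Random agents -/

lemma ae_tendsto_average {f : ℝ → ℝ} (hf : Measurable f) (hfi : Integrable f μ) :
    ∀ᵐ ω ∂(Measure.infinitePi fun _ : ℕ => μ),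
      Tendsto (fun n : ℕ => (1 / (n : ℝ)) * ∑ i, f (initial ω n i)) atTop (𝓝 (∫ x, f x ∂μ)) := by
  have hev := fun i : ℕ => measurePreserving_eval_infinitePi (fun _ : ℕ => μ) i
  have hint : Integrable (fun ω : ℕ → ℝ => f (ω 0)) (Measure.infinitePi fun _ : ℕ => μ) :=
    (hev 0).integrable_comp_of_integrable hfi
  have hmean : ∫ ω, f (ω 0) ∂(Measure.infinitePi fun _ : ℕ => μ) = ∫ x, f x ∂μ := by
    have h := integral_map (μ := Measure.infinitePi fun _ : ℕ => μ)
      (hev 0).measurable.aemeasurable (f := f) hf.aestronglyMeasurable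
    rw [(hev 0).map_eq] at h
    exact h.symm
  have hlaw := strong_law_ae_real (fun (i : ℕ) (ω : ℕ → ℝ) => f (ω i)) hint
    (fun i j hij => (iIndepFun_infinitePi (X := fun (_ : ℕ) => f) fun _ => hf).indepFun hij)
    fun i => by
      have h1 : IdentDistrib (Function.eval i) (Function.eval 0)
          (Measure.infinitePi fun _ : ℕ => μ) (Measure.infinitePi fun _ : ℕ => μ) :=
        ⟨(hev i).measurable.aemeasurable, (hev 0).measurable.aemeasurable,
          (hev i).map_eq.trans (hev 0).map_eq.symm⟩
      exact h1.comp hf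
  filter_upwards [hlaw] with ω hω
  rw [hmean] at hω
  refine hω.congr fun n => ?_
  rw [one_div_mul_eq_div, ← Fin.sum_univ_eq_sum_range (fun i => f (ω i)) n]
  rfl

lemma ae_isTypical (hsupp : μ (Icc (0 : ℝ) 1)ᶜ = 0) :
    ∀ᵐ ω ∂(Measure.infinitePi fun _ : ℕ => μ), IsTypical μ ω := by
  have h1 : ∀ᵐ ω ∂(Measure.infinitePi fun _ : ℕ => μ), ∀ i, ω i ∈ Icc (0 : ℝ) 1 :=
    ae_all_iff.2 fun i => (measurePreserving_eval_infinitePi (fun _ : ℕ => μ) i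
      ).quasiMeasurePreserving.ae (ae_mem_Icc hsupp)
  have h2 := ae_all_iff.2 fun t : ℚ => ae_all_iff.2 fun y : ℚ =>
    ae_tendsto_average (μ := μ) (f := fun x => max ((t : ℝ) - |x - y|) 0) (by fun_prop)
      (integrable_tent _ _)
  have h3 := ae_all_iff.2 fun s : ℚ =>
    ae_tendsto_average (μ := μ) (f := (Iic (s : ℝ)).indicator fun _ => (1 : ℝ))
      (measurable_const.indicator measurableSet_Iic)
      ((integrable_const _).indicator measurableSet_Iic)
  filter_upwards [h1, h2, h3] with ω hω1 hω2 hω3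
  refine ⟨hω1, hω2, fun s => ?_⟩
  have := hω3 s
  rwa [integral_indicator measurableSet_Iic, setIntegral_const, smul_eq_mul, mul_one,
    ← cdf_eq_real] at this

/-- All sample sizes are realized on one probability space, so almost sure convergence makes sense.
-/
lemma map_initial_infinitePi (n : ℕ) :
    (Measure.infinitePi fun _ : ℕ => μ).map (fun ω => initial ω n) =
      Measure.pi fun _ : Fin n => μ := by
  rw [← Measure.infinitePi_eq_pi]
  exact Measure.map_infinitePi_infinitePi_of_inj (P := fun _ : ℕ => μ) Fin.val_injective

lemma ae_pi_mem_Icc (hsupp : μ (Icc (0 : ℝ) 1)ᶜ = 0) (n : ℕ) :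
    ∀ᵐ x ∂(Measure.pi fun _ : Fin n => μ), ∀ i, x i ∈ Icc (0 : ℝ) 1 :=
  ae_all_iff.2 fun i => (measurePreserving_eval (fun _ : Fin n => μ) i
    ).quasiMeasurePreserving.ae (ae_mem_Icc hsupp)

/-- Bounded convergence for functions of the first `n` agents. -/
lemma tendsto_integral_pi (hsupp : μ (Icc (0 : ℝ) 1)ᶜ = 0) {f : (n : ℕ) → (Fin n → ℝ) → ℝ}
    (hf : ∀ n, Measurable (f n)) (hb : ∀ n x, (∀ i, x i ∈ Icc (0 : ℝ) 1) → |f n x| ≤ 1) {c : ℝ}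
    (hlim : ∀ x, IsTypical μ x → Tendsto (fun n => f n (initial x n)) atTop (𝓝 c)) :
    Tendsto (fun n => ∫ x, f n x ∂(Measure.pi fun _ => μ)) atTop (𝓝 c) := by
  have hini : ∀ n, Measurable fun ω : ℕ → ℝ => initial ω n := fun n =>
    measurable_pi_iff.2 fun i => measurable_pi_apply _
  have heq : ∀ n, ∫ x, f n x ∂(Measure.pi fun _ => μ) =
      ∫ ω, f n (initial ω n) ∂(Measure.infinitePi fun _ : ℕ => μ) := fun n => by
    rw [← map_initial_infinitePi, integral_map (hini n).aemeasurable (hf n).aestronglyMeasurable]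
  simp only [heq]
  have hc : ∫ _ω : ℕ → ℝ, c ∂(Measure.infinitePi fun _ : ℕ => μ) = c := by simp
  rw [← hc]
  refine tendsto_integral_of_dominated_convergence (fun _ => 1)
    (fun n => ((hf n).comp (hini n)).aestronglyMeasurable) (integrable_const _) (fun n => ?_) ?_
  · filter_upwards [ae_isTypical hsupp] with ω hω
    exact hb n _ fun i => hω.mem_Icc _
  · filter_upwards [ae_isTypical hsupp] with ω hω
    exact hlim ω hω

lemma abs_percentileWelfare_le_one (hq1 : q ≤ 1) (p : ℝ) {n : ℕ} {x : Fin n → ℝ}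
    (hx : ∀ i, x i ∈ Icc (0 : ℝ) 1) : |welfare q x (percentileMechanism p x)| ≤ 1 := by
  rw [abs_of_nonneg (welfare_nonneg fun i => abs_sub_le_one (hx i) (percentileMechanism_mem hx))]
  exact welfare_le_one hq1 _ _

lemma abs_optWelfare_le_one (hq1 : q ≤ 1) {n : ℕ} {x : Fin n → ℝ}
    (hx : ∀ i, x i ∈ Icc (0 : ℝ) 1) : |optWelfare q x| ≤ 1 := by
  have h0 : 0 ≤ welfare q x 0 :=
    welfare_nonneg fun i => abs_sub_le_one (hx i) ⟨le_rfl, zero_le_one⟩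
  rw [abs_of_nonneg (h0.trans (welfare_le_optWelfare hq1 x 0))]
  exact optWelfare_le_one hq1 x

lemma tendsto_expPercentileWelfare [NullSingletonClass μ] (hsupp : μ (Icc (0 : ℝ) 1)ᶜ = 0)
    (hq0 : 0 ≤ q) (hq1 : q ≤ 1) {y : ℝ} (hy : y ∈ Icc (0 : ℝ) 1) (hmin : IsMinOn (cost μ q) (Icc (0 : ℝ) 1) y) :
    Tendsto (expPercentileWelfare μ q (cdf μ y)) atTop (𝓝 (q - cost μ q y)) :=
  tendsto_integral_pi hsupp (f := fun _ x => welfare q x (percentileMechanism (cdf μ y) x))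
    (fun n => measurable_percentileWelfare hq1 _ n)
    (fun _ _ hx => abs_percentileWelfare_le_one hq1 _ hx)
    fun _ hx => hx.tendsto_percentileWelfare hsupp hq0 hq1 hy hmin

lemma tendsto_expOptWelfare [NullSingletonClass μ] (hsupp : μ (Icc (0 : ℝ) 1)ᶜ = 0)
    (hq0 : 0 ≤ q) (hq1 : q ≤ 1) {y : ℝ} (hy : y ∈ Icc (0 : ℝ) 1) (hmin : IsMinOn (cost μ q) (Icc (0 : ℝ) 1) y) :
    Tendsto (expOptWelfare μ q) atTop (𝓝 (q - cost μ q y)) :=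
  tendsto_integral_pi hsupp (f := fun _ x => optWelfare q x)
    (fun n => measurable_optWelfare hq1 n) (fun _ _ hx => abs_optWelfare_le_one hq1 hx)
    fun _ hx => hx.tendsto_optWelfare hsupp hq0 hq1 hy hmin

lemma expPercentileWelfare_nonneg (hsupp : μ (Icc (0 : ℝ) 1)ᶜ = 0) (p : ℝ) (n : ℕ) :
    0 ≤ expPercentileWelfare μ q p n := by
  refine integral_nonneg_of_ae ?_
  filter_upwards [ae_pi_mem_Icc hsupp n] with x hx
  exact welfare_nonneg fun i => abs_sub_le_one (hx i) (percentileMechanism_mem hx)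

lemma expPercentileWelfare_le_expOptWelfare (hsupp : μ (Icc (0 : ℝ) 1)ᶜ = 0) (hq1 : q ≤ 1)
    (p : ℝ) (n : ℕ) : expPercentileWelfare μ q p n ≤ expOptWelfare μ q n := by
  refine integral_mono ?_ ?_ fun x => welfare_le_optWelfare hq1 x _
  · refine .of_bound (measurable_percentileWelfare hq1 p n).aestronglyMeasurable 1 ?_
    filter_upwards [ae_pi_mem_Icc hsupp n] with x hx
    exact abs_percentileWelfare_le_one hq1 p hx
  · refine .of_bound (measurable_optWelfare hq1 n).aestronglyMeasurable 1 ?_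
    filter_upwards [ae_pi_mem_Icc hsupp n] with x hx
    exact abs_optWelfare_le_one hq1 hx

end FLPSR

theorem mainTheorem2 (μ : Measure ℝ) [IsProbabilityMeasure μ]
    (hac : μ ≪ volume) (hsupp : μ (Icc (0 : ℝ) 1)ᶜ = 0)
    (q : ℝ) (hq0 : 0 ≤ q) (hq1 : q ≤ 1) :
    -- the radius function solves its defining equation
    (∀ y ∈ Icc (0 : ℝ) 1, FLPSR.radius μ q y ∈ Icc (0 : ℝ) 1 ∧
      μ.real (Icc (y - FLPSR.radius μ q y) (y + FLPSR.radius μ q y)) = q) ∧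
    -- the one-facility problem has a solution
    (∃ y ∈ Icc (0 : ℝ) 1, IsMinOn (FLPSR.cost μ q) (Icc (0 : ℝ) 1) y) ∧
    -- every solution induces an asymptotically optimal percentile mechanism
    (∀ y ∈ Icc (0 : ℝ) 1, IsMinOn (FLPSR.cost μ q) (Icc (0 : ℝ) 1) y →
      Tendsto (FLPSR.expPercentileWelfare μ q (cdf μ y)) atTop (𝓝 (q - FLPSR.cost μ q y)) ∧
      Tendsto (FLPSR.expOptWelfare μ q) atTop (𝓝 (q - FLPSR.cost μ q y)) ∧
      (∀ p ∈ Icc (0 : ℝ) 1,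
        limsup (FLPSR.expPercentileWelfare μ q p) atTop ≤ q - FLPSR.cost μ q y) ∧
      (0 < q → Tendsto
        (fun n => FLPSR.expOptWelfare μ q n / FLPSR.expPercentileWelfare μ q (cdf μ y) n)
        atTop (𝓝 1))) := by
  -- Absolute continuity enters through the absence of atoms.
  have : NullSingletonClass μ := ⟨fun a => hac (measure_singleton a)⟩
  refine ⟨fun y hy => FLPSR.radius_spec hsupp hq0 hq1 hy,
    FLPSR.exists_isMinOn_cost hsupp hq0 hq1, fun y hy hmin => ?_⟩
  have hperc := FLPSR.tendsto_expPercentileWelfare hsupp hq0 hq1 hy hmin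
  have hopt := FLPSR.tendsto_expOptWelfare hsupp hq0 hq1 hy hmin
  refine ⟨hperc, hopt, fun p _ => ?_, fun hq => ?_⟩
  · rw [← hopt.limsup_eq]
    refine limsup_le_limsup
      (.of_forall fun n => FLPSR.expPercentileWelfare_le_expOptWelfare hsupp hq1 p n) ?_
      hopt.isBoundedUnder_le
    -- A real `limsup` is monotone only under boundedness conditions; nonnegativity supplies the
    -- lower one.
    exact isCoboundedUnder_le_of_le atTop
      fun n => FLPSR.expPercentileWelfare_nonneg hsupp p n
  · have hne : q - FLPSR.cost μ q y ≠ 0 := (sub_pos.2 (FLPSR.cost_lt hsupp hq hq1 hy)).ne'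
    exact div_self hne ▸ hopt.div hperc hne
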